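/- Let $C^*(T,I)$ denote the unital $C^*$-algebra generated by a bounded operator $T$ on a complex Hilbert space. A contraction $T$ is a universal contraction if for every contraction $S$ on a complex Hilbert space there is a unital $*$-homomorphism $C^*(T,I)\to C^*(S,I)$ taking $T$ to $S$. If $T_1,T_2$ are universal contractions, then $C^*(T_1,I)\cong C^*(T_2,I)$ via $T_1\mapsto T_2$; this algebra, with its distinguished generator, is denoted $\mathcal{A}$. An operator on a nonzero Hilbert space is irreducible if it has no nontrivial reducing subspace, and a representation on a nonzero Hilbert space is irreducible if it has no nontrivial closed invariant subspace. Theorem. The algebra $\mathcal{A}$ is primitive, i.e. for every universal contraction $T$, the algebra $C^*(T,I)$ has a faithful irreducible representation. Equivalently, there exist irreducible universal contractions; precisely, a unital representation $\pi$ of $C^*(T,I)$, with $T$ a universal contraction, is faithful and irreducible if and only if $\pi(T)$ is an irreducible universal contraction. Moreover, an irreducible universal contraction may be chosen of the form $D+C$, where $C$ is compact and $D=\bigoplus_{n\ge 1}\bigoplus_{k\ge 1} M_{n,k}$ is a direct sum of contractions $M_{n,k}\in\mathbb{M}_n(\mathbb{C})$ such that, for each $n$, $\{M_{n,k}:k\ge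 1\}$ is dense in the closed unit ball of $\mathbb{M}_n(\mathbb{C})=B(\mathbb{C}^n)$. -/

import Mathlib

universe u

/-- `C*(T, I)`: the unital C*-algebra generated by a bounded operator `T` on a complex Hilbert
space, that is, the norm closure of the unital *-subalgebra of `B(H)` generated by `T`. -/
noncomputable abbrev CStarGen {H : Type u} [NormedAddCommGroup H] [InnerProductSpace ℂ H] [CompleteSpace H]
    (T : H →L[ℂ] H) : StarSubalgebra ℂ (H →L[ℂ] H) :=
  StarAlgebra.elemental ℂ T

/-- The operator `T`, as the distinguished generator of `C*(T, I)`. -/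
noncomputable def CStarGen.gen {H : Type u} [NormedAddCommGroup H] [InnerProductSpace ℂ H] [CompleteSpace H]
    (T : H →L[ℂ] H) : CStarGen T :=
  ⟨T, StarAlgebra.elemental.self_mem ℂ T⟩

/-- A contraction `T` is universal if for every Hilbert space contraction `S` there is a unital
*-homomorphism `C*(T, I) → C*(S, I)` taking `T` to `S`. -/
def IsUniversalContraction {H : Type u} [NormedAddCommGroup H] [InnerProductSpace ℂ H]
    [CompleteSpace H] (T : H →L[ℂ] H) : Prop :=
  ‖T‖ ≤ 1 ∧
    ∀ (K : Type u) [NormedAddCommGroup K] [InnerProductSpace ℂ K] [CompleteSpace K]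
      (S : K →L[ℂ] K), ‖S‖ ≤ 1 →
        ∃ φ : CStarGen T →⋆ₐ[ℂ] CStarGen S, φ (CStarGen.gen T) = CStarGen.gen S

/-- An operator on a nonzero Hilbert space is irreducible if its only reducing subspaces (closed
subspaces invariant under the operator and its adjoint) are the trivial ones. -/
def IsIrreducibleOperator {H : Type u} [NormedAddCommGroup H] [InnerProductSpace ℂ H]
    [CompleteSpace H] (T : H →L[ℂ] H) : Prop :=
  Nontrivial H ∧
    ∀ M : Submodule ℂ H, IsClosed (M : Set H) →
      (∀ x ∈ M, T x ∈ M) → (∀ x ∈ M, ContinuousLinearMap.adjoint T x ∈ M) → M = ⊥ ∨ M = ⊤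

/-- A representation of a unital *-algebra on a nonzero Hilbert space is irreducible if its only
closed invariant subspaces are the trivial ones. -/
def IsIrreducibleRep {A : Type u} [Ring A] [StarRing A] [Algebra ℂ A]
    {K : Type u} [NormedAddCommGroup K] [InnerProductSpace ℂ K] [CompleteSpace K]
    (π : A →⋆ₐ[ℂ] (K →L[ℂ] K)) : Prop :=
  Nontrivial K ∧
    ∀ M : Submodule ℂ K, IsClosed (M : Set K) → (∀ a : A, ∀ x ∈ M, π a x ∈ M) → M = ⊥ ∨ M = ⊤

/-- A unital C*-algebra is primitive if it has a faithful irreducible representation. (Such a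
representation lives on a quotient of the algebra, so Hilbert spaces in the universe of `A`
suffice.) -/
def IsPrimitiveCStarAlgebra (A : Type u) [CStarAlgebra A] : Prop :=
  ∃ (K : Type u) (_ : NormedAddCommGroup K) (_ : InnerProductSpace ℂ K) (_ : CompleteSpace K)
    (π : A →⋆ₐ[ℂ] (K →L[ℂ] K)), Function.Injective π ∧ IsIrreducibleRep π

/-- `T` is (unitarily equivalent to) the Hilbert space direct sum of contractive matrices `M n k`
(`n, k ∈ ℕ`), where `M n k` acts on `ℂ^(n+1)` and, for each `n`, the matrices `M n k`, `k ∈ ℕ`, are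
dense in the unit ball of the `(n+1) × (n+1)` matrices (in the operator norm). The isometries `V p`
are the inclusions of the summands. -/
def IsDirectSumOfDenseMatrixContractions {H : Type u} [NormedAddCommGroup H]
    [InnerProductSpace ℂ H] [CompleteSpace H] (T : H →L[ℂ] H) : Prop :=
  ∃ (M : ∀ n : ℕ, ℕ → (EuclideanSpace ℂ (Fin (n + 1)) →L[ℂ] EuclideanSpace ℂ (Fin (n + 1))))
    (V : ∀ p : ℕ × ℕ, EuclideanSpace ℂ (Fin (p.1 + 1)) →ₗᵢ[ℂ] H),
    (∀ n k, ‖M n k‖ ≤ 1) ∧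
    (∀ n, Metric.closedBall 0 1 ⊆ closure (Set.range (M n))) ∧
    IsHilbertSum ℂ (fun p : ℕ × ℕ => EuclideanSpace ℂ (Fin (p.1 + 1))) V ∧
    ∀ (p : ℕ × ℕ) (x : EuclideanSpace ℂ (Fin (p.1 + 1))), T (V p x) = V p (M p.1 p.2 x)

/-! A contraction is the strong limit, jointly with its adjoint, of its compressions to
finite-dimensional subspaces. Hence a contraction is universal once every contractive matrix is, up
to a small error, a restriction of it, with the adjoints matching too
(`isUniversalContraction_of_matrix_approx`). A direct sum of matrices dense in the unit balls has
this property but is reducible. The property survives a compact perturbation that is small on the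
blocks used for approximation, so the perturbation only has to create irreducibility while keeping
the norm at most 1.

Shrinking the blocks makes room for it. If Γ and Δ multiply the i-th block by √(1 - δ i) and √(δ i),
then ΓÂΓ + ΔKΔ is a contraction for all contractions Â and K (`norm_adjoint_mul_mul_add_le_one`).
Take K = t(P + iR) with P diagonal in an eigenbasis of the real part of Â and R of rank one. For
suitable t, P makes the eigenvalues of the real part distinct, so each eigenvector lies in a given
reducing subspace or in its complement; R links different blocks and rules out a splitting
(`isIrreducibleOperator_of_eigenbasis`).

As for representations, an injective one is isometric and so preserves universality of the
generator, while universality of the image supplies a left inverse. Irreducibility passes between π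
and π(T) because T generates the algebra. -/

open Filter Topology
open scoped CStarAlgebra

/-! ### Homomorphisms between singly generated C*-algebras -/

/-- An injective `*`-homomorphism of C*-algebras has a left inverse on the C*-algebra generated by
any element of its range. -/
theorem exists_starAlgHom_elemental_of_injective {A B : Type*} [CStarAlgebra A] [CStarAlgebra B]
    (f : A →⋆ₐ[ℂ] B) (hf : Function.Injective f) (x : A) :
    ∃ φ : StarAlgebra.elemental ℂ (f x) →⋆ₐ[ℂ] A, ∀ y, f (φ y) = y := by
  have hcl : IsClosed (f.range : Set B) :=
    (NonUnitalStarAlgHom.isometry f hf).isClosedEmbedding.isClosed_range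
  have hle : StarAlgebra.elemental ℂ (f x) ≤ f.range :=
    StarAlgebra.elemental.le_of_mem hcl ⟨x, rfl⟩
  refine ⟨((StarAlgEquiv.ofInjective f hf).symm : f.range →⋆ₐ[ℂ] A).comp
    (StarSubalgebra.inclusion hle), fun y => ?_⟩
  have := (StarAlgEquiv.ofInjective f hf).apply_symm_apply (StarSubalgebra.inclusion hle y)
  exact congrArg Subtype.val this

/-- If the second coordinate is dominated by the first on the C*-algebra generated by `(T, S)`, then
`T ↦ S` extends to a `*`-homomorphism. -/
theorem exists_starAlgHom_elemental_of_norm_le {A B : Type*} [CStarAlgebra A] [CStarAlgebra B]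
    {T : A} {S : B} (h : ∀ a ∈ StarAlgebra.elemental ℂ (T, S), ‖a.2‖ ≤ ‖a.1‖) :
    ∃ φ : StarAlgebra.elemental ℂ T →⋆ₐ[ℂ] StarAlgebra.elemental ℂ S,
      φ ⟨T, StarAlgebra.elemental.self_mem ℂ T⟩ = ⟨S, StarAlgebra.elemental.self_mem ℂ S⟩ := by
  -- The algebra generated by `(T, S)` is the graph of the wanted homomorphism: the bound makes the
  -- first projection injective, and its inverse is followed by the second projection.
  let f : StarAlgebra.elemental ℂ (T, S) →⋆ₐ[ℂ] A :=
    (StarAlgHom.fst ℂ A B).comp (StarAlgebra.elemental ℂ (T, S)).subtype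
  have hf : Function.Injective f := by
    refine (injective_iff_map_eq_zero f).2 fun a ha => ?_
    have h1 : a.1.1 = 0 := ha
    have h2 : a.1.2 = 0 := by simpa [h1] using h a.1 a.2
    exact Subtype.ext (Prod.ext h1 h2)
  obtain ⟨φ, hφ⟩ := exists_starAlgHom_elemental_of_injective f hf
    ⟨(T, S), StarAlgebra.elemental.self_mem ℂ (T, S)⟩
  have hle : StarAlgebra.elemental ℂ (T, S) ≤
      (StarAlgebra.elemental ℂ S).comap (StarAlgHom.snd ℂ A B) :=
    StarAlgebra.elemental.le_of_mem
      ((StarAlgebra.elemental.isClosed ℂ S).preimage continuous_snd)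
      (StarAlgebra.elemental.self_mem ℂ S)
  let g : StarAlgebra.elemental ℂ (T, S) →⋆ₐ[ℂ] StarAlgebra.elemental ℂ S :=
    ((StarAlgHom.snd ℂ A B).comp (StarAlgebra.elemental ℂ (T, S)).subtype).codRestrict _
      fun a => hle a.2
  refine ⟨g.comp φ, ?_⟩
  have hx : φ ⟨T, StarAlgebra.elemental.self_mem ℂ T⟩ =
      ⟨(T, S), StarAlgebra.elemental.self_mem ℂ (T, S)⟩ := hf (hφ _)
  exact (congrArg g hx).trans rfl

/-! ### Asymptotic intertwining -/

section AsymptoticIntertwining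

variable {H K : Type*} [NormedAddCommGroup H] [InnerProductSpace ℂ H] [CompleteSpace H]
  [NormedAddCommGroup K] [InnerProductSpace ℂ K] [CompleteSpace K]

/-- The pairs of operators that are intertwined, together with their adjoints, in the limit along
a net of contractions. -/
noncomputable def asymptoticIntertwiners {ι : Type*} (l : Filter ι) (Y : ι → K →L[ℂ] H) :
    StarSubalgebra ℂ ((H →L[ℂ] H) × (K →L[ℂ] K)) where
  carrier := {a | (∀ x, Tendsto (fun i => a.1 (Y i x) - Y i (a.2 x)) l (𝓝 0)) ∧
    ∀ x, Tendsto (fun i => (star a.1) (Y i x) - Y i ((star a.2) x)) l (𝓝 0)}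
  mul_mem' := by
    have key : ∀ (a b : (H →L[ℂ] H) × (K →L[ℂ] K)),
        (∀ x, Tendsto (fun i => a.1 (Y i x) - Y i (a.2 x)) l (𝓝 0)) →
        (∀ x, Tendsto (fun i => b.1 (Y i x) - Y i (b.2 x)) l (𝓝 0)) →
        ∀ x, Tendsto (fun i => (a.1 * b.1) (Y i x) - Y i ((a.2 * b.2) x)) l (𝓝 0) := by
      intro a b ha hb x
      -- abY - Yab = a(bY - Yb) + (aY - Ya)b.
      have h1 := ((a.1.continuous.tendsto 0).comp (hb x)).add (ha (b.2 x))
      simp only [map_zero, add_zero] at h1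
      refine h1.congr fun i => ?_
      simp
    intro a b ha hb
    refine ⟨key a b ha.1 hb.1, ?_⟩
    simpa using key (star b) (star a) hb.2 ha.2
  add_mem' := by
    intro a b ha hb
    refine ⟨fun x => ?_, fun x => ?_⟩
    · have := (ha.1 x).add (hb.1 x)
      rw [add_zero] at this
      refine this.congr fun i => ?_
      simp only [Prod.fst_add, Prod.snd_add, add_apply, map_add]
      abel
    · have := (ha.2 x).add (hb.2 x)
      rw [add_zero] at this
      refine this.congr fun i => ?_
      simp only [Prod.fst_add, Prod.snd_add, star_add, add_apply, map_add]
      abel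
  algebraMap_mem' := by
    intro r
    constructor <;> intro x <;>
      simp [Algebra.algebraMap_eq_smul_one, tendsto_const_nhds]
  star_mem' := by
    intro a ha
    exact ⟨ha.2, by simpa using ha.1⟩

/-- Since each `Y i` is a contraction, replacing `a` by a nearby `b` changes the intertwining error
at `x` by at most 2‖a - b‖‖x‖, uniformly in `i`. -/
theorem isClosed_asymptoticIntertwiners {ι : Type*} (l : Filter ι) (Y : ι → K →L[ℂ] H)
    (hY : ∀ i, ‖Y i‖ ≤ 1) : IsClosed (asymptoticIntertwiners l Y : Set ((H →L[ℂ] H) × (K →L[ℂ] K))) := by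
  have key : IsClosed {a : (H →L[ℂ] H) × (K →L[ℂ] K) |
      ∀ x, Tendsto (fun i => a.1 (Y i x) - Y i (a.2 x)) l (𝓝 0)} := by
    refine isClosed_of_closure_subset fun a ha x => ?_
    rw [Metric.tendsto_nhds]
    intro ε hε
    obtain ⟨b, hb, hab⟩ := Metric.mem_closure_iff.1 ha (ε / 4 / (‖x‖ + 1)) (by positivity)
    filter_upwards [Metric.tendsto_nhds.1 (hb x) (ε / 4) (by positivity)] with i hi
    rw [dist_zero_right] at hi ⊢
    have hab' : ‖a - b‖ * ‖x‖ ≤ ε / 4 := by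
      rw [dist_eq_norm] at hab
      calc ‖a - b‖ * ‖x‖ ≤ ε / 4 / (‖x‖ + 1) * (‖x‖ + 1) := by gcongr; linarith
        _ = ε / 4 := by field_simp
    have hYx : ∀ z, ‖Y i z‖ ≤ ‖z‖ := fun z => by
      simpa using (Y i).le_of_opNorm_le (hY i) z
    have h1 : ‖(a.1 - b.1) (Y i x)‖ ≤ ε / 4 := by
      refine ((a.1 - b.1).le_opNorm _).trans (le_trans ?_ hab')
      exact mul_le_mul (norm_fst_le (a - b)) (hYx x) (norm_nonneg _) (norm_nonneg _)
    have h2 : ‖Y i ((a.2 - b.2) x)‖ ≤ ε / 4 := by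
      refine (hYx _).trans (((a.2 - b.2).le_opNorm _).trans (le_trans ?_ hab'))
      exact mul_le_mul_of_nonneg_right (norm_snd_le (a - b)) (norm_nonneg _)
    have h3 : a.1 (Y i x) - Y i (a.2 x) = (a.1 - b.1) (Y i x) - Y i ((a.2 - b.2) x) +
        (b.1 (Y i x) - Y i (b.2 x)) := by
      simp only [sub_apply, map_sub]; abel
    rw [h3]
    have h4 := norm_add_le ((a.1 - b.1) (Y i x) - Y i ((a.2 - b.2) x))
      (b.1 (Y i x) - Y i (b.2 x))
    have h5 := norm_sub_le ((a.1 - b.1) (Y i x)) (Y i ((a.2 - b.2) x))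
    linarith
  exact key.inter (key.preimage continuous_star)

/-- If a contraction `S` can be approximately found, jointly with its adjoint, inside `T` on every
finite set of vectors, then `T ↦ S` extends to a `*`-homomorphism. -/
theorem exists_starAlgHom_elemental_of_approx {T : H →L[ℂ] H} {S : K →L[ℂ] K}
    (h : ∀ (s : Finset K) (ε : ℝ), 0 < ε → ∃ Y : K →L[ℂ] H, ‖Y‖ ≤ 1 ∧ ∀ x ∈ s, ‖Y x‖ = ‖x‖ ∧
      ‖T (Y x) - Y (S x)‖ ≤ ε ∧ ‖(star T) (Y x) - Y ((star S) x)‖ ≤ ε) :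
    ∃ φ : StarAlgebra.elemental ℂ T →⋆ₐ[ℂ] StarAlgebra.elemental ℂ S,
      φ ⟨T, StarAlgebra.elemental.self_mem ℂ T⟩ = ⟨S, StarAlgebra.elemental.self_mem ℂ S⟩ := by
  classical
  -- The index pairs a finite set with an accuracy, so along `atTop` each vector is eventually in
  -- the set while the error tends to 0.
  choose Y hY hYs using fun p : Finset K × ℕ => h p.1 (1 / ((p.2 : ℝ) + 1)) (by positivity)
  have hmem : ∀ x : K, ∀ᶠ p : Finset K × ℕ in atTop, x ∈ p.1 := fun x =>
    (eventually_ge_atTop (({x} : Finset K), 0)).mono fun p hp =>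
      Finset.singleton_subset_iff.1 hp.1
  have hlim : Tendsto (fun p : Finset K × ℕ => 1 / ((p.2 : ℝ) + 1)) atTop (𝓝 0) :=
    by
    rw [← prod_atTop_atTop_eq]
    exact tendsto_one_div_add_atTop_nhds_zero_nat.comp tendsto_snd
  have hTS : (T, S) ∈ asymptoticIntertwiners atTop Y :=
    ⟨fun x => squeeze_zero_norm' ((hmem x).mono fun p hp => (hYs p x hp).2.1) hlim,
      fun x => squeeze_zero_norm' ((hmem x).mono fun p hp => (hYs p x hp).2.2) hlim⟩
  have hle := StarAlgebra.elemental.le_of_mem (isClosed_asymptoticIntertwiners atTop Y hY) hTS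
  refine exists_starAlgHom_elemental_of_norm_le fun a ha => ?_
  refine a.2.opNorm_le_bound (norm_nonneg _) fun x => ?_
  -- Once the finite set contains both `x` and `a.2 x`, ‖a.2 x‖ = ‖Y (a.2 x)‖ is at most ‖a.1 (Y x)‖
  -- + o(1), hence at most ‖a.1‖‖x‖ + o(1).
  have h0 := ((hle ha).1 x).norm
  rw [norm_zero] at h0
  refine ge_of_tendsto (h0.const_add (‖a.1‖ * ‖x‖) |>.trans_eq (by rw [add_zero])) ?_
  filter_upwards [hmem (a.2 x), hmem x] with p hp hp'
  rw [← (hYs p _ hp).1]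
  have h1 := norm_sub_norm_le (Y p (a.2 x)) (a.1 (Y p x))
  rw [norm_sub_rev] at h1
  have h2 := a.1.le_opNorm (Y p x)
  rw [(hYs p x hp').1] at h2
  linarith

end AsymptoticIntertwining

/-! ### Universality from finite matrices -/

/-- A contraction is universal as soon as all contractive matrices occur approximately, jointly with
their adjoints, as restrictions of it. -/
theorem isUniversalContraction_of_matrix_approx {H : Type u} [NormedAddCommGroup H]
    [InnerProductSpace ℂ H] [CompleteSpace H] {T : H →L[ℂ] H} (hT : ‖T‖ ≤ 1)
    (h : ∀ (n : ℕ) (M : EuclideanSpace ℂ (Fin (n + 1)) →L[ℂ] EuclideanSpace ℂ (Fin (n + 1))),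
      ‖M‖ ≤ 1 → ∀ ε : ℝ, 0 < ε → ∃ W : EuclideanSpace ℂ (Fin (n + 1)) →ₗᵢ[ℂ] H,
        ∀ y, ‖T (W y) - W (M y)‖ ≤ ε * ‖y‖ ∧ ‖(star T) (W y) - W ((star M) y)‖ ≤ ε * ‖y‖) :
    IsUniversalContraction T := by
  refine ⟨hT, fun K _ _ _ S hS => exists_starAlgHom_elemental_of_approx fun s ε hε => ?_⟩
  let F : Submodule ℂ K := Submodule.span ℂ (s : Set K)
  have hsF : ∀ x ∈ s, x ∈ F := fun x hx => Submodule.subset_span hx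
  -- Matrix sizes start at 1, so the zero span is treated apart.
  by_cases hF : F = ⊥
  · refine ⟨0, by simp, fun x hx => ?_⟩
    have hx0 : x = 0 := by simpa [hF] using hsF x hx
    simp [hx0, hε.le]
  have : FiniteDimensional ℂ F := FiniteDimensional.span_finset ℂ s
  obtain ⟨n, hn⟩ : ∃ n, Module.finrank ℂ F = n + 1 :=
    Nat.exists_eq_succ_of_ne_zero fun h0 => hF (Submodule.finrank_eq_zero.1 h0)
  let J := ((stdOrthonormalBasis ℂ F).reindex (finCongr hn)).repr
  let V : EuclideanSpace ℂ (Fin (n + 1)) →ₗᵢ[ℂ] K :=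
    F.subtypeₗᵢ.comp J.symm.toLinearIsometry
  have hVs : ∀ x ∈ s, ∃ y, V y = x := fun x hx => ⟨J ⟨x, hsF x hx⟩, by simp [V]⟩
  let v : EuclideanSpace ℂ (Fin (n + 1)) →L[ℂ] K := V.toContinuousLinearMap
  have hv : ‖v‖ ≤ 1 := V.norm_toContinuousLinearMap_le
  have hv' : ‖ContinuousLinearMap.adjoint v‖ ≤ 1 := by
    rwa [LinearIsometryEquiv.norm_map]
  have hvv : ∀ y, ContinuousLinearMap.adjoint v (v y) = y := fun y => by
    refine ext_inner_right ℂ fun z => ?_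
    rw [ContinuousLinearMap.adjoint_inner_left]
    exact V.inner_map_map y z
  let M := (ContinuousLinearMap.adjoint v) ∘L S ∘L v
  have hM : ‖M‖ ≤ 1 := by
    refine (ContinuousLinearMap.opNorm_comp_le _ _).trans (mul_le_one₀ hv' (norm_nonneg _) ?_)
    exact (ContinuousLinearMap.opNorm_comp_le _ _).trans (mul_le_one₀ hS (norm_nonneg _) hv)
  have hMstar : star M = (ContinuousLinearMap.adjoint v) ∘L (star S) ∘L v := by
    simp only [M, ContinuousLinearMap.star_eq_adjoint, ContinuousLinearMap.adjoint_comp,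
      ContinuousLinearMap.adjoint_adjoint, ContinuousLinearMap.comp_assoc]
  have hsum : 0 ≤ ∑ x ∈ s, ‖x‖ := Finset.sum_nonneg fun x _ => norm_nonneg x
  -- The error of `W` is relative to ‖y‖; the denominator exceeds the norm of every vector in `s`.
  obtain ⟨W, hW⟩ := h n M hM (ε / (1 + ∑ x ∈ s, ‖x‖)) (by positivity)
  -- `F` need not be invariant under `S`: as v* projects onto `F`, Wv*S(vy) = WMy exactly, and
  -- likewise for the adjoints.
  refine ⟨W.toContinuousLinearMap ∘L ContinuousLinearMap.adjoint v, ?_, fun x hx => ?_⟩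
  · exact (ContinuousLinearMap.opNorm_comp_le _ _).trans
      (mul_le_one₀ W.norm_toContinuousLinearMap_le (norm_nonneg _) hv')
  obtain ⟨y, rfl⟩ := hVs x hx
  have hy : ε / (1 + ∑ x ∈ s, ‖x‖) * ‖y‖ ≤ ε := by
    have h1 : ‖y‖ ≤ 1 + ∑ x ∈ s, ‖x‖ := by
      have := Finset.single_le_sum (f := fun x : K => ‖x‖) (fun x _ => norm_nonneg x) hx
      simp only [V.norm_map] at this
      linarith
    calc ε / (1 + ∑ x ∈ s, ‖x‖) * ‖y‖
        ≤ ε / (1 + ∑ x ∈ s, ‖x‖) * (1 + ∑ x ∈ s, ‖x‖) := by gcongr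
      _ = ε := by field_simp
  have hvy : ContinuousLinearMap.adjoint v (V y) = y := hvv y
  obtain ⟨h1, h2⟩ := hW y
  rw [hMstar] at h2
  refine ⟨?_, ?_, ?_⟩
  · simp [hvy]
  · refine le_trans ?_ (h1.trans hy)
    simp [hvy, M, v]
  · refine le_trans ?_ (h2.trans hy)
    simp [hvy, v]

/-! ### Faithful irreducible representations -/

/-- A `*`-homomorphism on a singly generated C*-algebra takes values in every C*-subalgebra that
contains the image of the generator. -/
theorem starAlgHom_elemental_apply_mem {A B : Type*} [CStarAlgebra A] [CStarAlgebra B] {x : A}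
    (π : StarAlgebra.elemental ℂ x →⋆ₐ[ℂ] B) {S : StarSubalgebra ℂ B} (hS : IsClosed (S : Set B))
    (hx : π ⟨x, StarAlgebra.elemental.self_mem ℂ x⟩ ∈ S) (a : StarAlgebra.elemental ℂ x) :
    π a ∈ S := by
  have hπ : Continuous π := map_continuous π
  obtain ⟨y, hy⟩ := a
  induction hy using StarAlgebra.elemental.induction_on with
  | self => exact hx
  | star_self =>
    have := star_mem hx
    rwa [← map_star] at this
  | algebraMap r =>
    have : π ⟨algebraMap ℂ _ r, algebraMap_mem _ r⟩ = algebraMap ℂ _ r := AlgHomClass.commutes π r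
    rw [this]
    exact algebraMap_mem S r
  | add p hp q hq ihp ihq =>
    have : π ⟨p + q, add_mem hp hq⟩ = π ⟨p, hp⟩ + π ⟨q, hq⟩ := map_add π ⟨p, hp⟩ ⟨q, hq⟩
    rw [this]
    exact add_mem ihp ihq
  | mul p hp q hq ihp ihq =>
    have : π ⟨p * q, mul_mem hp hq⟩ = π ⟨p, hp⟩ * π ⟨q, hq⟩ := map_mul π ⟨p, hp⟩ ⟨q, hq⟩
    rw [this]
    exact mul_mem ihp ihq
  | closure s hs ih p hp =>
    obtain ⟨q, hq, hqp⟩ := mem_closure_iff_seq_limit.1 hp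
    have hlim : Tendsto (fun n => (⟨q n, hs (hq n)⟩ : StarAlgebra.elemental ℂ x)) atTop
        (𝓝 ⟨p, closure_minimal hs (StarAlgebra.elemental.isClosed ℂ x) hp⟩) :=
      tendsto_subtype_rng.2 hqp
    exact hS.mem_of_tendsto (hπ.continuousAt.tendsto.comp hlim)
      (Eventually.of_forall fun n => ih _ (hq n))

/-- A `*`-homomorphism on a singly generated C*-algebra is injective if some `*`-homomorphism takes
the image of the generator back to the generator. -/
theorem starAlgHom_elemental_injective {A B : Type*} [CStarAlgebra A] [CStarAlgebra B] {x : A}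
    (π : StarAlgebra.elemental ℂ x →⋆ₐ[ℂ] B) {y : B}
    (hy : π ⟨x, StarAlgebra.elemental.self_mem ℂ x⟩ = y)
    (φ : StarAlgebra.elemental ℂ y →⋆ₐ[ℂ] StarAlgebra.elemental ℂ x)
    (hφ : φ ⟨y, StarAlgebra.elemental.self_mem ℂ y⟩ = ⟨x, StarAlgebra.elemental.self_mem ℂ x⟩) :
    Function.Injective π := by
  have hmem : ∀ a, π a ∈ StarAlgebra.elemental ℂ y :=
    starAlgHom_elemental_apply_mem π (StarAlgebra.elemental.isClosed ℂ y)
      (hy ▸ StarAlgebra.elemental.self_mem ℂ y)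
  -- φ ∘ π fixes the generator, hence is the identity.
  let ρ := φ.comp (π.codRestrict _ hmem)
  have hρ : ρ ⟨x, StarAlgebra.elemental.self_mem ℂ x⟩ =
      ⟨x, StarAlgebra.elemental.self_mem ℂ x⟩ := (congrArg φ (Subtype.ext hy)).trans hφ
  have hid : ρ = StarAlgHom.id ℂ _ :=
    StarAlgebra.elemental.starAlgHomClass_ext ℂ (map_continuous ρ) continuous_id hρ
  intro a b hab
  have hab' : π.codRestrict _ hmem a = π.codRestrict _ hmem b := Subtype.ext hab
  have h1 : ρ a = ρ b := congrArg φ hab'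
  rwa [hid] at h1

/-- An injective `*`-homomorphism on a singly generated C*-algebra does not change what the generator
can be mapped to. -/
theorem exists_starAlgHom_elemental_map_gen {A B C : Type*} [CStarAlgebra A] [CStarAlgebra B]
    [CStarAlgebra C] {x : A} (π : StarAlgebra.elemental ℂ x →⋆ₐ[ℂ] B) (hπ : Function.Injective π)
    {y : B} (hy : π ⟨x, StarAlgebra.elemental.self_mem ℂ x⟩ = y)
    (ψ : StarAlgebra.elemental ℂ x →⋆ₐ[ℂ] C) :
    ∃ χ : StarAlgebra.elemental ℂ y →⋆ₐ[ℂ] C,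
      χ ⟨y, StarAlgebra.elemental.self_mem ℂ y⟩ =
        ψ ⟨x, StarAlgebra.elemental.self_mem ℂ x⟩ := by
  subst hy
  obtain ⟨φ, hφ⟩ := exists_starAlgHom_elemental_of_injective π hπ
    ⟨x, StarAlgebra.elemental.self_mem ℂ x⟩
  exact ⟨ψ.comp φ, congrArg ψ (hπ (hφ _))⟩

/-- The algebra of the operators that a subspace reduces. -/
def reducedOperators {K : Type*} [NormedAddCommGroup K] [InnerProductSpace ℂ K] [CompleteSpace K]
    (M : Submodule ℂ K) : StarSubalgebra ℂ (K →L[ℂ] K) where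
  carrier := {b | (∀ x ∈ M, b x ∈ M) ∧ ∀ x ∈ M, (star b) x ∈ M}
  mul_mem' := by
    intro a b ha hb
    refine ⟨fun x hx => ha.1 _ (hb.1 x hx), fun x hx => ?_⟩
    rw [star_mul]
    exact hb.2 _ (ha.2 x hx)
  add_mem' := by
    intro a b ha hb
    refine ⟨fun x hx => M.add_mem (ha.1 x hx) (hb.1 x hx), fun x hx => ?_⟩
    rw [star_add]
    exact M.add_mem (ha.2 x hx) (hb.2 x hx)
  algebraMap_mem' := by
    intro r
    refine ⟨fun x hx => ?_, fun x hx => ?_⟩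
    · rw [Algebra.algebraMap_eq_smul_one]
      exact M.smul_mem r hx
    · rw [Algebra.algebraMap_eq_smul_one, star_smul, star_one]
      exact M.smul_mem _ hx
  star_mem' := by
    intro a ha
    exact ⟨ha.2, by simpa using ha.1⟩

theorem isClosed_reducedOperators {K : Type*} [NormedAddCommGroup K] [InnerProductSpace ℂ K]
    [CompleteSpace K] {M : Submodule ℂ K} (hM : IsClosed (M : Set K)) :
    IsClosed (reducedOperators M : Set (K →L[ℂ] K)) := by
  have key : IsClosed {b : K →L[ℂ] K | ∀ x ∈ M, b x ∈ M} := by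
    simp only [Set.ofPred_forall]
    exact isClosed_iInter fun x => isClosed_iInter fun _ =>
      hM.preimage (ContinuousLinearMap.apply ℂ K x).continuous
  exact key.inter (key.preimage continuous_star)

/-- The faithful irreducible representations of the algebra of a universal contraction are those that
send the generator to an irreducible universal contraction. -/
theorem injective_and_isIrreducibleRep_iff {H K : Type u} [NormedAddCommGroup H]
    [InnerProductSpace ℂ H] [CompleteSpace H] [NormedAddCommGroup K] [InnerProductSpace ℂ K]
    [CompleteSpace K] {T : H →L[ℂ] H} (hT : IsUniversalContraction T)
    (π : CStarGen T →⋆ₐ[ℂ] (K →L[ℂ] K)) :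
    (Function.Injective π ∧ IsIrreducibleRep π) ↔
      (IsUniversalContraction (π (CStarGen.gen T)) ∧
        IsIrreducibleOperator (π (CStarGen.gen T))) := by
  constructor
  · rintro ⟨hπ, hK, hirr⟩
    refine ⟨⟨?_, fun L _ _ _ S hS => ?_⟩, hK, fun M hM h1 h2 => ?_⟩
    · rw [NonUnitalStarAlgHom.norm_map π hπ]
      exact hT.1
    · obtain ⟨ψ, hψ⟩ := hT.2 L S hS
      obtain ⟨χ, hχ⟩ := exists_starAlgHom_elemental_map_gen π hπ rfl ψ
      exact ⟨χ, hχ.trans hψ⟩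
    · exact hirr M hM fun a => (starAlgHom_elemental_apply_mem π (isClosed_reducedOperators hM)
        ⟨h1, h2⟩ a).1
  · rintro ⟨hU, hK, hirr⟩
    refine ⟨?_, hK, fun M hM h => hirr M hM (h _) fun x hx => ?_⟩
    · obtain ⟨φ, hφ⟩ := hU.2 H T hT.1
      exact starAlgHom_elemental_injective π rfl φ hφ
    · have := h (star (CStarGen.gen T)) x hx
      rwa [map_star, ContinuousLinearMap.star_eq_adjoint] at this

/-- If some universal contraction is irreducible, then the algebra of every universal contraction is
primitive. -/
theorem isPrimitiveCStarAlgebra_of_isUniversalContraction {H K : Type u} [NormedAddCommGroup H]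
    [InnerProductSpace ℂ H] [CompleteSpace H] [NormedAddCommGroup K] [InnerProductSpace ℂ K]
    [CompleteSpace K] {T : H →L[ℂ] H} (hT : IsUniversalContraction T) {S : K →L[ℂ] K}
    (hS : IsUniversalContraction S) (hS' : IsIrreducibleOperator S) :
    IsPrimitiveCStarAlgebra (CStarGen T) := by
  obtain ⟨φ, hφ⟩ := hT.2 K S hS.1
  let π : CStarGen T →⋆ₐ[ℂ] (K →L[ℂ] K) := (CStarGen S).subtype.comp φ
  have hπ : π (CStarGen.gen T) = S := congrArg Subtype.val hφ
  exact ⟨K, inferInstance, inferInstance, inferInstance, π,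
    (injective_and_isIrreducibleRep_iff hT π).2 (by rw [hπ]; exact ⟨hS, hS'⟩)⟩

/-! ### Ingredients of the perturbation -/

/-- An operator is irreducible if its real part is diagonal with distinct eigenvalues in some
orthonormal basis, any two vectors of which are linked by its imaginary part through a third. -/
theorem isIrreducibleOperator_of_eigenbasis {H : Type u} [NormedAddCommGroup H]
    [InnerProductSpace ℂ H] [CompleteSpace H] {T : H →L[ℂ] H} {κ : Type*} [Nonempty κ] {e : κ → H}
    (he : Orthonormal ℂ e) (htot : ∀ z, (∀ q, inner ℂ (e q) z = 0) → z = 0) {c : κ → ℝ}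
    (hc : Function.Injective c) (hce : ∀ q, (T + star T) (e q) = (c q : ℂ) • e q)
    (hlink : ∀ q r, ∃ s, inner ℂ (e s) ((T - star T) (e q)) ≠ 0 ∧
      inner ℂ (e s) ((T - star T) (e r)) ≠ 0) :
    IsIrreducibleOperator T := by
  obtain ⟨q₀⟩ := ‹Nonempty κ›
  refine ⟨⟨e q₀, 0, fun h0 => by simpa [h0] using he.1 q₀⟩, fun M hM h1 h2 => ?_⟩
  have : CompleteSpace M := hM.completeSpace_coe
  have hsym : ∀ x y, inner ℂ ((T + star T) x) y = inner ℂ x ((T + star T) y) := fun x y => by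
    simp only [add_apply, inner_add_left, inner_add_right,
      ContinuousLinearMap.star_eq_adjoint, ContinuousLinearMap.adjoint_inner_left,
      ContinuousLinearMap.adjoint_inner_right]
    rw [add_comm]
  have hadd : ∀ x ∈ M, (T + star T) x ∈ M := fun x hx => M.add_mem (h1 x hx) (h2 x hx)
  have hsub : ∀ x ∈ M, (T - star T) x ∈ M := fun x hx => M.sub_mem (h1 x hx) (h2 x hx)
  have hsub' : ∀ x ∈ Mᗮ, (T - star T) x ∈ Mᗮ := fun x hx => by
    rw [Submodule.mem_orthogonal] at hx ⊢
    intro y hy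
    simp only [sub_apply, inner_sub_right, ContinuousLinearMap.star_eq_adjoint,
      ContinuousLinearMap.adjoint_inner_right]
    rw [← ContinuousLinearMap.adjoint_inner_left, hx _ (h1 y hy), hx _ (h2 y hy), sub_zero]
  have hcase : ∀ q, e q ∈ M ∨ e q ∈ Mᗮ := by
    intro q
    obtain ⟨y, hy, z, hz, hyz⟩ := M.exists_add_mem_mem_orthogonal (e q)
    have hyeig : (T + star T) y = (c q : ℂ) • y := by
      -- This difference lies in `M`. It is also minus the corresponding expression in `z`, which is
      -- orthogonal to `M` by symmetry, so it vanishes.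
      rw [← sub_eq_zero, ← inner_self_eq_zero (𝕜 := ℂ)]
      have hw : (T + star T) y - (c q : ℂ) • y ∈ M := M.sub_mem (hadd y hy) (M.smul_mem _ hy)
      have hw' : (T + star T) y - (c q : ℂ) • y = -((T + star T) z - (c q : ℂ) • z) := by
        have := hce q
        rw [hyz, map_add, smul_add] at this
        rw [neg_sub, sub_eq_sub_iff_add_eq_add, this, add_comm]
      nth_rw 2 [hw']
      rw [inner_neg_right, inner_sub_right, ← hsym, inner_smul_right,
        Submodule.inner_right_of_mem_orthogonal (hadd _ hw) hz,
        Submodule.inner_right_of_mem_orthogonal hw hz]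
      simp
    have hy' : ∀ r, r ≠ q → inner ℂ (e r) y = 0 := by
      intro r hr
      have := hsym (e r) y
      rw [hce, hyeig, inner_smul_left, inner_smul_right, Complex.conj_ofReal] at this
      by_contra h0
      exact hr (hc (Complex.ofReal_injective (mul_right_cancel₀ h0 this)))
    -- Eigenvalues are distinct, so the component of `e q` in `M` is a multiple of `e q`.
    have hye : y = inner ℂ (e q) y • e q := by
      rw [← sub_eq_zero]
      refine htot _ fun r => ?_
      rw [inner_sub_right, inner_smul_right]
      rcases eq_or_ne r q with rfl | hr
      · simp [inner_self_eq_norm_sq_to_K, he.1 r]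
      · rw [hy' r hr, he.2 hr]; simp
    by_cases h0 : inner ℂ (e q) y = 0
    · right
      rw [h0, zero_smul] at hye
      rwa [hyz, hye, zero_add]
    · left
      rw [hye] at hy
      exact (M.smul_mem_iff h0).1 hy
  by_cases hall : ∀ q, e q ∈ M
  · right
    rw [← Submodule.orthogonal_eq_bot_iff, Submodule.eq_bot_iff]
    exact fun z hz => htot z fun q => Submodule.inner_right_of_mem_orthogonal (hall q) hz
  · left
    push Not at hall
    obtain ⟨q, hq⟩ := hall
    have hq' := (hcase q).resolve_left hq
    rw [Submodule.eq_bot_iff]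
    refine fun z hz => htot z fun r => ?_
    refine Submodule.inner_left_of_mem_orthogonal hz ((hcase r).resolve_left fun hr => ?_)
    -- With `e q` in `Mᗮ` and `e r` in `M`, the linking vector `e s` could lie in neither.
    obtain ⟨s, hs1, hs2⟩ := hlink q r
    rcases hcase s with hs | hs
    · exact hs1 (Submodule.inner_right_of_mem_orthogonal hs (hsub' _ hq'))
    · exact hs2 (Submodule.inner_left_of_mem_orthogonal (hsub _ hr) hs)

/-- Compressing two contractions by a column isometry and adding gives a contraction. -/
theorem norm_adjoint_mul_mul_add_le_one {H : Type*} [NormedAddCommGroup H] [InnerProductSpace ℂ H]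
    [CompleteSpace H] {G D A B : H →L[ℂ] H} (hGD : star G * G + star D * D = 1) (hA : ‖A‖ ≤ 1)
    (hB : ‖B‖ ≤ 1) : ‖star G * A * G + star D * B * D‖ ≤ 1 := by
  have hsq : ∀ x, ‖G x‖ ^ 2 + ‖D x‖ ^ 2 = ‖x‖ ^ 2 := fun x => by
    have h := congrArg (fun R : H →L[ℂ] H => RCLike.re (inner ℂ x (R x))) hGD
    simp only [add_apply, mul_apply_eq_comp, inner_add_right,
      ContinuousLinearMap.star_eq_adjoint, ContinuousLinearMap.adjoint_inner_right, map_add,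
      one_apply_eq_self, inner_self_eq_norm_sq] at h
    exact h
  refine ContinuousLinearMap.opNorm_le_bound _ zero_le_one fun x => ?_
  set w := (star G * A * G + star D * B * D) x with hw
  have h1 : ‖w‖ ^ 2 ≤ ‖G w‖ * ‖G x‖ + ‖D w‖ * ‖D x‖ := by
    have h2 : inner ℂ w w = inner ℂ (G w) (A (G x)) + inner ℂ (D w) (B (D x)) := by
      nth_rw 2 [hw]
      simp only [add_apply, mul_apply_eq_comp, inner_add_right,
        ContinuousLinearMap.star_eq_adjoint, ContinuousLinearMap.adjoint_inner_right]
    have h3 : ‖w‖ ^ 2 = ‖inner ℂ w w‖ := by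
      rw [inner_self_eq_norm_sq_to_K]; simp
    rw [h3, h2]
    refine (norm_add_le _ _).trans (add_le_add ?_ ?_)
    · refine (norm_inner_le_norm _ _).trans ?_
      gcongr
      simpa using A.le_of_opNorm_le hA (G x)
    · refine (norm_inner_le_norm _ _).trans ?_
      gcongr
      simpa using B.le_of_opNorm_le hB (D x)
  have hw2 := hsq w
  have hx2 := hsq x
  rw [one_mul]
  refine le_of_sq_le_sq ?_ (norm_nonneg x)
  -- By AM-GM, ‖w‖² ≤ (‖w‖² + ‖x‖²)/2.
  nlinarith [sq_nonneg (‖G w‖ - ‖G x‖), sq_nonneg (‖D w‖ - ‖D x‖)]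

/-- Lines with distinct slopes take distinct values at arbitrarily small positive times. -/
theorem exists_pos_lt_injective_add_mul {κ : Type*} [Countable κ] (a b : κ → ℝ)
    (hb : Function.Injective b) {t₀ : ℝ} (ht₀ : 0 < t₀) :
    ∃ t, 0 < t ∧ t < t₀ ∧ Function.Injective fun q => a q + t * b q := by
  -- Two lines of different slopes meet at most once, so the bad times are countable.
  let B : Set ℝ := ⋃ p : κ × κ, {t | p.1 ≠ p.2 ∧ a p.1 + t * b p.1 = a p.2 + t * b p.2}
  have hB : B.Countable := by
    refine Set.countable_iUnion fun p => Set.Subsingleton.countable ?_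
    rintro s ⟨hp, hs⟩ t ⟨-, ht⟩
    have hne : b p.1 - b p.2 ≠ 0 := sub_ne_zero.2 (hb.ne hp)
    refine mul_right_cancel₀ hne ?_
    linarith
  obtain ⟨t, htB, ht0, ht1⟩ := (hB.dense_compl ℝ).exists_between ht₀
  refine ⟨t, ht0, ht1, fun q r hqr => ?_⟩
  by_contra hne
  exact htB (Set.mem_iUnion.2 ⟨(q, r), hne, hqr⟩)

open InnerProductSpace in
theorem isCompactOperator_rankOne {H : Type*} [NormedAddCommGroup H] [InnerProductSpace ℂ H]
    (x y : H) : IsCompactOperator (rankOne ℂ x y) := by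
  have h : IsCompactOperator (ContinuousLinearMap.toSpanSingleton ℂ x) :=
    isCompactOperator_of_locallyCompactSpace_rng (ContinuousLinearMap.toSpanSingleton ℂ x)
  rw [rankOne_def']
  exact h.comp_clm (innerSL ℂ y)

open InnerProductSpace in
/-- A compact self-adjoint operator that is diagonal with prescribed summable eigenvalues, and a
self-adjoint operator of rank one with the products of these eigenvalues as matrix entries. -/
theorem exists_compact_diagonal_and_rankOne {H κ : Type*} [NormedAddCommGroup H]
    [InnerProductSpace ℂ H] [CompleteSpace H] {e : κ → H} (he : Orthonormal ℂ e) {w : κ → ℝ}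
    (hw : ∀ q, 0 < w q) (hsum : Summable w) :
    ∃ P R : H →L[ℂ] H, IsCompactOperator P ∧ IsCompactOperator R ∧ star P = P ∧ star R = R ∧
      (∀ q, P (e q) = (w q : ℂ) • e q) ∧ ∀ r q, inner ℂ (e r) (R (e q)) = w r * w q := by
  have h1 : Summable fun q => (w q : ℂ) • rankOne ℂ (e q) (e q) :=
    Summable.of_norm (by simpa [norm_smul, he.1, abs_of_pos (hw _)] using hsum)
  have h2 : Summable fun q => (w q : ℂ) • e q :=
    Summable.of_norm (by simpa [norm_smul, he.1, abs_of_pos (hw _)] using hsum)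
  set v : H := ∑' q, (w q : ℂ) • e q with hv
  have hev : ∀ r, inner ℂ (e r) v = w r := fun r => by
    have := (innerSL ℂ (e r)).map_tsum h2
    rw [innerSL_apply_apply] at this
    rw [this, tsum_eq_single r]
    · simp [inner_self_eq_norm_sq_to_K, he.1 r]
    · intro s hs
      simp [he.2 hs.symm]
  refine ⟨∑' q, (w q : ℂ) • rankOne ℂ (e q) (e q), rankOne ℂ v v, ?_,
    isCompactOperator_rankOne v v, ?_, ?_, fun q => ?_, fun r q => ?_⟩
  · refine isCompactOperator_of_tendsto h1.hasSum (Eventually.of_forall fun s => ?_)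
    exact Submodule.sum_mem (compactOperator (RingHom.id ℂ) H H) fun q _ =>
      Submodule.smul_mem _ _ (isCompactOperator_rankOne (e q) (e q))
  · rw [tsum_star]
    refine tsum_congr fun q => ?_
    rw [star_smul, ContinuousLinearMap.star_eq_adjoint, adjoint_rankOne]
    simp
  · rw [ContinuousLinearMap.star_eq_adjoint, adjoint_rankOne]
  · have := (ContinuousLinearMap.apply ℂ H (e q)).map_tsum h1
    rw [ContinuousLinearMap.apply_apply] at this
    rw [this, tsum_eq_single q]
    · simp [he.1 q]
    · intro s hs
      simp [he.2 hs]
  · rw [rankOne_apply, inner_smul_right, hev, ← inner_conj_symm, hev, Complex.conj_ofReal, mul_comm]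

/-! ### Block diagonal operators and their irreducible perturbations -/

section BlockDiagonal

variable {ι : Type*} {G : ι → Type*} [∀ i, NormedAddCommGroup (G i)]
  [∀ i, InnerProductSpace ℂ (G i)]

theorem lp.mapCLM_single [DecidableEq ι] (A : ∀ i, G i →L[ℂ] G i) {K : ℝ} (hK : 0 ≤ K)
    (hA : ∀ i, ‖A i‖ ≤ K) (i : ι) (x : G i) :
    lp.mapCLM 2 A hK hA (lp.single 2 i x) = lp.single 2 i (A i x) := by
  ext j
  rw [lp.mapCLM_apply_coe]
  rcases eq_or_ne j i with rfl | h
  · simp only [lp.single_apply_self]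
  · simp only [lp.single_apply_ne _ _ _ h, map_zero]

theorem lp.star_mapCLM [∀ i, CompleteSpace (G i)] (A : ∀ i, G i →L[ℂ] G i) {K : ℝ} (hK : 0 ≤ K)
    (hA : ∀ i, ‖A i‖ ≤ K) :
    star (lp.mapCLM 2 A hK hA) =
      lp.mapCLM 2 (fun i => star (A i)) hK (fun i => by rw [norm_star]; exact hA i) := by
  rw [ContinuousLinearMap.star_eq_adjoint, eq_comm, ContinuousLinearMap.eq_adjoint_iff]
  intro x y
  rw [lp.inner_eq_tsum, lp.inner_eq_tsum]
  refine tsum_congr fun i => ?_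
  rw [lp.mapCLM_apply_coe, lp.mapCLM_apply_coe, ContinuousLinearMap.star_eq_adjoint,
    ContinuousLinearMap.adjoint_inner_left]

/-- Every block diagonal contraction with finite-dimensional blocks, once its blocks are scaled down
to have norm less than `1`, has a compact perturbation that is an irreducible contraction. -/
theorem exists_irreducible_compact_perturbation [DecidableEq ι] [Infinite ι] [Countable ι]
    [∀ i, FiniteDimensional ℂ (G i)] [∀ i, CompleteSpace (G i)] {d : ι → ℕ}
    (hd : ∀ i, Module.finrank ℂ (G i) = d i) (hd0 : ∀ i, 0 < d i) {A : ∀ i, G i →L[ℂ] G i}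
    (hA : ∀ i, ‖A i‖ ≤ 1) {δ : ι → ℝ} (hδ0 : ∀ i, 0 < δ i) (hδ1 : ∀ i, δ i < 1)
    {w : (Σ i, Fin (d i)) → ℝ} (hw : ∀ q, 0 < w q) (hsum : Summable w)
    (hinj : Function.Injective fun q => δ q.1 * w q) :
    ∃ D C : lp G 2 →L[ℂ] lp G 2, ‖D + C‖ ≤ 1 ∧ IsIrreducibleOperator (D + C) ∧
      IsCompactOperator C ∧
      (∀ i x, D (lp.single 2 i x) = lp.single 2 i (((1 - δ i : ℝ) : ℂ) • A i x)) ∧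
      (∀ i x, (star D) (lp.single 2 i x) =
        lp.single 2 i (((1 - δ i : ℝ) : ℂ) • (star (A i)) x)) ∧
      (∀ i x, ‖C (lp.single 2 i x)‖ ≤ √(δ i) * ‖x‖) ∧
      ∀ i x, ‖(star C) (lp.single 2 i x)‖ ≤ √(δ i) * ‖x‖ := by
  have hscal : ∀ f : ι → ℝ, (∀ i, 0 ≤ f i) → (∀ i, f i ≤ 1) →
      ∃ X : lp G 2 →L[ℂ] lp G 2, star X = X ∧ ‖X‖ ≤ 1 ∧ ∀ y i, X y i = ((√(f i) : ℝ) : ℂ) • y i := by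
    intro f hf0 hf1
    have hb : ∀ i, ‖((√(f i) : ℝ) : ℂ) • (1 : G i →L[ℂ] G i)‖ ≤ 1 := fun i => by
      refine ContinuousLinearMap.opNorm_le_bound _ zero_le_one fun x => ?_
      rw [smul_apply, one_apply_eq_self, norm_smul, Complex.norm_real,
        Real.norm_of_nonneg (Real.sqrt_nonneg _)]
      exact mul_le_mul_of_nonneg_right (Real.sqrt_le_one.2 (hf1 i)) (norm_nonneg x)
    refine ⟨lp.mapCLM 2 _ zero_le_one hb, ?_, lp.norm_mapCLM_le 2 _ zero_le_one hb, fun y i => ?_⟩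
    · rw [lp.star_mapCLM]
      congr
      ext1 i
      rw [star_smul, star_one, Complex.star_def, Complex.conj_ofReal]
    · rw [lp.mapCLM_apply_coe]; simp
  have hsingle : ∀ (X : lp G 2 →L[ℂ] lp G 2) (c : ι → ℂ), (∀ y i, X y i = c i • y i) →
      ∀ i x, X (lp.single 2 i x) = c i • lp.single 2 i x := by
    intro X c hX i x
    ext j
    rw [hX, lp.coeFn_smul, Pi.smul_apply]
    rcases eq_or_ne j i with rfl | h
    · rfl
    · simp only [lp.single_apply_ne _ _ _ h, smul_zero]
  obtain ⟨Γ, hΓs, -, hΓ⟩ := hscal (fun i => 1 - δ i) (fun i => by linarith [hδ1 i])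
    (fun i => by linarith [hδ0 i])
  obtain ⟨Δ, hΔs, hΔn, hΔ⟩ := hscal δ (fun i => (hδ0 i).le) (fun i => (hδ1 i).le)
  have hΓ1 := hsingle Γ _ hΓ
  have hΔ1 := hsingle Δ _ hΔ
  have hsq : ∀ {r : ℝ}, 0 ≤ r → ((√r : ℝ) : ℂ) * ((√r : ℝ) : ℂ) = r := fun {r} hr => by
    rw [← Complex.ofReal_mul, Real.mul_self_sqrt hr]
  have hΓΔ : star Γ * Γ + star Δ * Δ = 1 := by
    rw [hΓs, hΔs]
    ext y i
    rw [add_apply, mul_apply_eq_comp, mul_apply_eq_comp, lp.coeFn_add, Pi.add_apply, hΓ, hΓ, hΔ, hΔ,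
      smul_smul, smul_smul, hsq (by linarith [hδ1 i]), hsq (hδ0 i).le, ← add_smul]
    simp
  let Â := lp.mapCLM 2 A zero_le_one hA
  let D := star Γ * Â * Γ
  have hD : ∀ i x, D (lp.single 2 i x) = lp.single 2 i (((1 - δ i : ℝ) : ℂ) • A i x) := by
    intro i x
    simp only [D, Â, hΓs, mul_apply_eq_comp, hΓ1, map_smul, lp.mapCLM_single, smul_smul,
      hsq (show 0 ≤ 1 - δ i by linarith [hδ1 i]), lp.single_smul]
  have hDs : ∀ i x, (star D) (lp.single 2 i x) =
      lp.single 2 i (((1 - δ i : ℝ) : ℂ) • (star (A i)) x) := by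
    intro i x
    simp only [D, Â, star_mul, hΓs, lp.star_mapCLM, mul_apply_eq_comp, hΓ1, map_smul,
      lp.mapCLM_single, smul_smul, hsq (show 0 ≤ 1 - δ i by linarith [hδ1 i]), lp.single_smul]
  have hsymm : ∀ i, ((A i + star (A i) : G i →L[ℂ] G i) : G i →ₗ[ℂ] G i).IsSymmetric := fun i =>
    (ContinuousLinearMap.isSelfAdjoint_iff_isSymmetric).1 (IsSelfAdjoint.add_star_self (A i))
  let b := fun i => (hsymm i).eigenvectorBasis (hd i)
  let μ := fun i => (hsymm i).eigenvalues (hd i)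
  have hbμ : ∀ i j, (A i) (b i j) + (star (A i)) (b i j) = (μ i j : ℂ) • b i j := fun i j =>
    (hsymm i).apply_eigenvectorBasis (hd i) j
  let e : (Σ i, Fin (d i)) → lp G 2 := fun q => lp.single 2 q.1 (b q.1 q.2)
  have he : Orthonormal ℂ e := by
    refine ⟨fun q => ?_, fun q r hqr => ?_⟩
    · rw [lp.norm_single (by norm_num), (b q.1).norm_eq_one]
    · obtain ⟨i, j⟩ := q
      obtain ⟨i', j'⟩ := r
      simp only [e, lp.inner_single_left]
      rcases eq_or_ne i i' with rfl | h
      · rw [lp.single_apply_self]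
        exact (b i).orthonormal.2 fun hj => hqr (by rw [hj])
      · rw [lp.single_apply_ne _ _ _ h, inner_zero_right]
  have htot : ∀ z, (∀ q, inner ℂ (e q) z = 0) → z = 0 := by
    intro z hz
    ext i
    refine (b i).repr.injective (PiLp.ext fun j => ?_)
    have := hz ⟨i, j⟩
    simp only [e, lp.inner_single_left] at this
    simp [(b i).repr_apply_apply, this]
  obtain ⟨P, R, hP, hR, hPs, hRs, hPe, hRe⟩ := exists_compact_diagonal_and_rankOne he hw hsum
  -- The function made injective gives the eigenvalues of (D + C) + (D + C)* at `e q`; the upper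
  -- bound on `t` makes `K` a contraction.
  obtain ⟨t, ht0, ht1, htinj⟩ := exists_pos_lt_injective_add_mul
    (fun q : Σ i, Fin (d i) => (1 - δ q.1) * μ q.1 q.2) (fun q => 2 * (δ q.1 * w q))
    (fun q r h => hinj (mul_left_cancel₀ two_ne_zero h))
    (show 0 < 1 / (‖P + Complex.I • R‖ + 1) by positivity)
  let K := (t : ℂ) • (P + Complex.I • R)
  have hK : ‖K‖ ≤ 1 := by
    rw [norm_smul, Complex.norm_real, Real.norm_of_nonneg ht0.le]
    calc t * ‖P + Complex.I • R‖ ≤ 1 / (‖P + Complex.I • R‖ + 1) * (‖P + Complex.I • R‖ + 1) := by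
          gcongr; linarith
      _ = 1 := by field_simp
  have hKs : star K = (t : ℂ) • (P - Complex.I • R) := by
    simp only [K, star_smul, star_add, hPs, hRs, Complex.star_def, Complex.conj_ofReal,
      Complex.conj_I]
    module
  have hKs1 : ‖star K‖ ≤ 1 := by rwa [norm_star]
  have hKadd : K + star K = ((2 * t : ℝ) : ℂ) • P := by
    rw [hKs]; simp only [K]; push_cast; module
  have hKsub : K - star K = (2 * t * Complex.I : ℂ) • R := by
    rw [hKs]; simp only [K]; module
  let C := star Δ * K * Δ
  have hCs : star C = star Δ * star K * Δ := by
    simp only [C, star_mul, star_star, mul_assoc]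
  have hCn : ∀ L : lp G 2 →L[ℂ] lp G 2, ‖L‖ ≤ 1 → ∀ i x,
      ‖(star Δ * L * Δ) (lp.single 2 i x)‖ ≤ √(δ i) * ‖x‖ := by
    intro L hL i x
    have h1 := Δ.le_of_opNorm_le hΔn (L (Δ (lp.single 2 i x)))
    have h2 := L.le_of_opNorm_le hL (Δ (lp.single 2 i x))
    rw [one_mul] at h1 h2
    rw [hΔs, mul_apply_eq_comp, mul_apply_eq_comp]
    refine h1.trans (h2.trans_eq ?_)
    rw [hΔ1, norm_smul, Complex.norm_real, Real.norm_of_nonneg (Real.sqrt_nonneg _),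
      lp.norm_single (by norm_num)]
  have hCadd : C + star C = Δ * (K + star K) * Δ := by
    rw [hCs]; simp only [C, hΔs]; noncomm_ring
  have hCsub : C - star C = Δ * (K - star K) * Δ := by
    rw [hCs]; simp only [C, hΔs]; noncomm_ring
  have hΔe : ∀ q, Δ (e q) = ((√(δ q.1) : ℝ) : ℂ) • e q := fun q => hΔ1 _ _
  have : Nonempty (Σ i, Fin (d i)) := ⟨⟨Classical.arbitrary ι, ⟨0, hd0 _⟩⟩⟩
  -- Between different blocks `D` contributes nothing, so only the nonzero entry from `R` remains.
  have hne : ∀ s q : Σ i, Fin (d i), q.1 ≠ s.1 →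
      inner ℂ (e s) ((D + C - star (D + C)) (e q)) ≠ 0 := by
    intro s q hsq
    have h1 : D + C - star (D + C) = D - star D + (C - star C) := by rw [star_add]; abel
    have h2 : inner ℂ (e s) ((D - star D) (e q)) = 0 := by
      simp only [e, sub_apply, hD, hDs, inner_sub_right, lp.inner_single_left,
        lp.single_apply_ne _ _ _ hsq.symm, inner_zero_right, sub_zero]
    have h3 : inner ℂ (e s) ((C - star C) (e q)) =
        ((√(δ q.1) : ℝ) : ℂ) * ((2 * t * Complex.I) * (((√(δ s.1) : ℝ) : ℂ) * (w s * w q))) := by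
      rw [hCsub, hKsub, mul_apply_eq_comp, mul_apply_eq_comp, hΔe, map_smul, map_smul,
        inner_smul_right, smul_apply, map_smul, inner_smul_right, ← hRe]
      congr 2
      have h4 : inner ℂ (e s) (Δ (R (e q))) = inner ℂ (Δ (e s)) (R (e q)) := by
        nth_rw 1 [← hΔs]
        rw [ContinuousLinearMap.star_eq_adjoint, ContinuousLinearMap.adjoint_inner_right]
      rw [h4, hΔe, inner_smul_left, Complex.conj_ofReal]
    rw [h1, add_apply, inner_add_right, h2, zero_add, h3]
    have hs' := (Real.sqrt_pos.2 (hδ0 s.1)).ne'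
    have hq' := (Real.sqrt_pos.2 (hδ0 q.1)).ne'
    simp only [ne_eq, mul_eq_zero, Complex.ofReal_eq_zero, hs', hq', ht0.ne', (hw s).ne', (hw q).ne',
      Complex.I_ne_zero, OfNat.ofNat_ne_zero, or_self, not_false_eq_true]
  refine ⟨D, C, norm_adjoint_mul_mul_add_le_one hΓΔ (lp.norm_mapCLM_le 2 A zero_le_one hA) hK,
    isIrreducibleOperator_of_eigenbasis he htot htinj (fun q => ?_) (fun q r => ?_), ?_, hD, hDs,
    hCn K hK, fun i x => by rw [hCs]; exact hCn _ hKs1 i x⟩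
  · have h1 : D + C + star (D + C) = D + star D + (C + star C) := by rw [star_add]; abel
    have h2 : (D + star D) (e q) = (((1 - δ q.1) * μ q.1 q.2 : ℝ) : ℂ) • e q := by
      simp only [e, add_apply, hD, hDs, ← lp.single_add, ← smul_add, hbμ, lp.single_smul, smul_smul,
        Complex.ofReal_mul]
    have h3 : (C + star C) (e q) = ((t * (2 * (δ q.1 * w q)) : ℝ) : ℂ) • e q := by
      rw [hCadd, hKadd, mul_apply_eq_comp, mul_apply_eq_comp, hΔe, map_smul, map_smul, smul_apply,
        hPe, map_smul, map_smul, hΔe, smul_smul, smul_smul, smul_smul]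
      congr 1
      have := hsq (hδ0 q.1).le
      push_cast
      linear_combination (2 * t * w q : ℂ) * this
    rw [h1, add_apply, h2, h3, ← add_smul, ← Complex.ofReal_add]
  -- Entries within one block may cancel against those of `D`; a third block avoids this.
  · obtain ⟨i, hi⟩ := Infinite.exists_notMem_finset ({q.1, r.1} : Finset ι)
    simp only [Finset.mem_insert, Finset.mem_singleton, not_or] at hi
    exact ⟨⟨i, ⟨0, hd0 i⟩⟩, hne _ _ (Ne.symm hi.1), hne _ _ (Ne.symm hi.2)⟩
  · have hKc : IsCompactOperator K := (hP.add (hR.smul Complex.I)).smul (t : ℂ)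
    exact (hKc.clm_comp (star Δ)).comp_clm Δ

end BlockDiagonal

/-! ### Construction of the irreducible universal contraction -/

/-- The closed unit ball of the matrices of a given size has a dense sequence. -/
theorem exists_denseSeq_closedBall_matrix (n : ℕ) :
    ∃ M : ℕ → (EuclideanSpace ℂ (Fin (n + 1)) →L[ℂ] EuclideanSpace ℂ (Fin (n + 1))),
      (∀ k, ‖M k‖ ≤ 1) ∧ Metric.closedBall 0 1 ⊆ closure (Set.range M) := by
  let X := EuclideanSpace ℂ (Fin (n + 1)) →L[ℂ] EuclideanSpace ℂ (Fin (n + 1))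
  have : ProperSpace X := FiniteDimensional.proper ℂ X
  let B : Set X := Metric.closedBall 0 1
  have : Nonempty B := ⟨⟨0, by simp [B]⟩⟩
  refine ⟨fun k => TopologicalSpace.denseSeq B k,
    fun k => mem_closedBall_zero_iff.1 (TopologicalSpace.denseSeq B k).2, fun x hx => ?_⟩
  have h := (TopologicalSpace.denseRange_denseSeq B) ⟨x, hx⟩
  have h2 := image_closure_subset_closure_image continuous_subtype_val ⟨_, h, rfl⟩
  rwa [← Set.range_comp] at h2

/-- Scaling a dense sequence of the unit ball by factors tending to `1`, with every term repeated
infinitely often, keeps it dense. -/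
theorem exists_scaled_denseSeq_near {X : Type*} [NormedAddCommGroup X] [NormedSpace ℂ X] {M : ℕ → X}
    (hM : ∀ k, ‖M k‖ ≤ 1) (hd : Metric.closedBall 0 1 ⊆ closure (Set.range M)) {δ : ℕ → ℝ}
    (hδ0 : ∀ k, 0 ≤ δ k) (hδ : Tendsto δ atTop (𝓝 0)) {x : X} (hx : ‖x‖ ≤ 1) {ε : ℝ} (hε : 0 < ε) :
    ∃ k, δ k < ε ∧ ‖((1 - δ k : ℝ) : ℂ) • M (Nat.unpair k).1 - x‖ < ε := by
  obtain ⟨_, ⟨m, rfl⟩, hm⟩ := Metric.mem_closure_iff.1 (hd (mem_closedBall_zero_iff.2 hx)) (ε / 2)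
    (by positivity)
  obtain ⟨N, hN⟩ := eventually_atTop.1 (hδ.eventually_lt_const (half_pos hε))
  -- Pairing `m` with `N` gives an index that is at least `N`, so δ is small there, and still names
  -- `M m`.
  have hk := hN (Nat.pair m N) (Nat.right_le_pair m N)
  refine ⟨Nat.pair m N, by linarith, ?_⟩
  rw [Nat.unpair_pair]
  have h1 : ((1 - δ (Nat.pair m N) : ℝ) : ℂ) • M m - x =
      -((δ (Nat.pair m N) : ℂ) • M m) - (x - M m) := by push_cast; module
  rw [h1]
  refine (norm_sub_le _ _).trans_lt ?_
  rw [← dist_eq_norm x, norm_neg, norm_smul, Complex.norm_real, Real.norm_of_nonneg (hδ0 _)]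
  nlinarith [hM m, hδ0 (Nat.pair m N)]

theorem norm_ofReal_smul_star_sub_star {A : Type*} [CStarAlgebra A] (r : ℝ) (a b : A) :
    ‖(r : ℂ) • star a - star b‖ = ‖(r : ℂ) • a - b‖ := by
  rw [← norm_star ((r : ℂ) • a - b), star_sub, star_smul, Complex.star_def, Complex.conj_ofReal]

/-- There is an irreducible universal contraction that is a compact perturbation of a direct sum of
matrices dense in the unit balls. -/
theorem exists_irreducible_universal_contraction :
    ∃ (H : Type u) (_ : NormedAddCommGroup H) (_ : InnerProductSpace ℂ H) (_ : CompleteSpace H)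
      (T : H →L[ℂ] H),
      IsUniversalContraction T ∧ IsIrreducibleOperator T ∧
        ∃ D C : H →L[ℂ] H,
          IsDirectSumOfDenseMatrixContractions D ∧ IsCompactOperator C ∧ T = D + C := by
  choose M hM hMd using exists_denseSeq_closedBall_matrix
  let δ : ℕ → ℝ := fun k => (1 / 2) ^ (k + 1)
  have hδ0 : ∀ k, 0 < δ k := fun k => by positivity
  have hδ1 : ∀ k, δ k < 1 := fun k => pow_lt_one₀ (by norm_num) (by norm_num) k.succ_ne_zero
  have hδ : Tendsto δ atTop (𝓝 0) :=
    (tendsto_add_atTop_iff_nat 1).2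
      (tendsto_pow_atTop_nhds_zero_of_lt_one (by norm_num : (0 : ℝ) ≤ 1 / 2) (by norm_num))
  -- Lifting the index set puts the Hilbert sum in universe `u`.
  let G : ULift.{u} (ℕ × ℕ) → Type := fun i => EuclideanSpace ℂ (Fin (i.down.1 + 1))
  let A : ∀ i : ULift.{u} (ℕ × ℕ), G i →L[ℂ] G i := fun i => M i.down.1 (Nat.unpair i.down.2).1
  let c : (Σ i : ULift.{u} (ℕ × ℕ), Fin (i.down.1 + 1)) → ℕ := fun q =>
    Nat.pair q.1.down.2 (Nat.pair q.1.down.1 q.2)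
  have hc : Function.Injective c := by
    rintro ⟨⟨n, k⟩, j⟩ ⟨⟨n', k'⟩, j'⟩ h
    simp only [c, Nat.pair_eq_pair] at h
    obtain ⟨rfl, rfl, h⟩ := h
    rw [Fin.ext h]
  have hck : ∀ q, q.1.down.2 ≤ c q := fun q => Nat.left_le_pair _ _
  -- The exponent makes δ·w equal to (1/2)^(2c + 1), injective because `c` is; `hck` keeps the
  -- natural subtraction from truncating. Also w ≤ (1/2)^c, which is summable.
  let w : (Σ i : ULift.{u} (ℕ × ℕ), Fin (i.down.1 + 1)) → ℝ := fun q =>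
    (1 / 2) ^ (c q - q.1.down.2 + c q)
  have hsum : Summable w := by
    refine Summable.of_nonneg_of_le (fun q => by positivity) (fun q => ?_)
      (summable_geometric_two.comp_injective hc)
    exact pow_le_pow_of_le_one (by norm_num) (by norm_num) (Nat.le_add_left _ _)
  have hinj : Function.Injective fun q => δ q.1.down.2 * w q := by
    intro q r h
    simp only [δ, w, ← pow_add] at h
    have h1 := pow_right_injective₀ (by norm_num : (0 : ℝ) < 1 / 2) (by norm_num) h
    have hq := hck q
    have hr := hck r
    exact hc (by omega)
  obtain ⟨D, C, hDC, hirr, hC, hD, hDs, hCn, hCsn⟩ := exists_irreducible_compact_perturbation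
    (G := G) (d := fun i => i.down.1 + 1) (fun i => finrank_euclideanSpace_fin)
    (fun i => Nat.succ_pos _) (A := A) (fun i => hM _ _) (δ := fun i => δ i.down.2)
    (fun i => hδ0 _) (fun i => hδ1 _) (w := w) (fun q => by positivity) hsum hinj
  let V : ∀ p : ℕ × ℕ, EuclideanSpace ℂ (Fin (p.1 + 1)) →ₗᵢ[ℂ] lp G 2 := fun p =>
    ⟨lp.lsingle (𝕜 := ℂ) (E := G) 2 (ULift.up p), fun x => lp.norm_single (E := G) two_pos _ x⟩
  have hV : ∀ p x, V p x = lp.single (E := G) 2 (ULift.up p) x := fun p x => rfl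
  refine ⟨lp G 2, inferInstance, inferInstance, inferInstance, D + C,
    isUniversalContraction_of_matrix_approx hDC fun n N hN ε hε => ?_, hirr, D, C, ?_, hC, rfl⟩
  -- Half of ε is for the matrix error; the square is there because `C` and its adjoint are bounded
  -- by √δ on the block.
  · obtain ⟨k, hk1, hk2⟩ := exists_scaled_denseSeq_near (hM n) (hMd n) (fun k => (hδ0 k).le) hδ hN
      (show 0 < min (ε / 2) ((ε / 2) ^ 2) by positivity)
    have hsq : √(δ k) ≤ ε / 2 := Real.sqrt_le_iff.2 ⟨by positivity, (hk1.trans_le (min_le_right _ _)).le⟩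
    have hk2' := (hk2.trans_le (min_le_left _ _)).le
    have hk3 : ‖((1 - δ k : ℝ) : ℂ) • star (M n (Nat.unpair k).1) - star N‖ ≤ ε / 2 :=
      (norm_ofReal_smul_star_sub_star _ _ _).trans_le hk2'
    refine ⟨V (n, k), fun y => ⟨?_, ?_⟩⟩
    · have h1 : (D + C) (V (n, k) y) - V (n, k) (N y) =
          V (n, k) ((((1 - δ k : ℝ) : ℂ) • M n (Nat.unpair k).1 - N) y) + C (V (n, k) y) := by
        rw [add_apply, sub_apply, map_sub, smul_apply, hV (n, k) y, hD]
        simp only [hV, A]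
        abel
      rw [h1]
      refine (norm_add_le _ _).trans ?_
      rw [(V (n, k)).norm_map]
      have h2 := ContinuousLinearMap.le_of_opNorm_le _ hk2' y
      have h3 := (hCn (ULift.up (n, k)) y).trans (mul_le_mul_of_nonneg_right hsq (norm_nonneg y))
      rw [← hV] at h3
      linarith
    · have h1 : (star (D + C)) (V (n, k) y) - V (n, k) ((star N) y) =
          V (n, k) ((((1 - δ k : ℝ) : ℂ) • star (M n (Nat.unpair k).1) - star N) y) +
            (star C) (V (n, k) y) := by
        rw [star_add, add_apply, sub_apply, map_sub, smul_apply, hV (n, k) y, hDs]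
        simp only [hV, A]
        abel
      rw [h1]
      refine (norm_add_le _ _).trans ?_
      rw [(V (n, k)).norm_map]
      have h2 := ContinuousLinearMap.le_of_opNorm_le _ hk3 y
      have h3 := (hCsn (ULift.up (n, k)) y).trans (mul_le_mul_of_nonneg_right hsq (norm_nonneg y))
      rw [← hV] at h3
      linarith
  · refine ⟨fun n k => ((1 - δ k : ℝ) : ℂ) • M n (Nat.unpair k).1, V, fun n k => ?_, fun n x hx => ?_,
      IsHilbertSum.mk (fun p r hpr x y => ?_) ?_, fun p x => hD _ x⟩
    · rw [norm_smul, Complex.norm_real, Real.norm_of_nonneg (by linarith [hδ1 k])]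
      exact mul_le_one₀ (by linarith [hδ0 k]) (norm_nonneg _) (hM n _)
    · refine Metric.mem_closure_iff.2 fun ε hε => ?_
      obtain ⟨k, -, hk⟩ := exists_scaled_denseSeq_near (hM n) (hMd n) (fun k => (hδ0 k).le) hδ
        (mem_closedBall_zero_iff.1 hx) hε
      exact ⟨_, ⟨k, rfl⟩, by rwa [dist_comm, dist_eq_norm]⟩
    · have hpr' : (ULift.up p : ULift.{u} (ℕ × ℕ)) ≠ ULift.up r := fun h => hpr (ULift.up_injective h)
      rw [hV, hV, lp.inner_single_left, lp.single_apply_ne _ _ _ hpr', inner_zero_right]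
    · rw [top_le_iff, Submodule.topologicalClosure_eq_top_iff, Submodule.eq_bot_iff]
      intro z hz
      ext i : 2
      refine ext_inner_left ℂ fun x => ?_
      have hx : V i.down x ∈ ⨆ p, LinearMap.range (V p).toLinearMap :=
        Submodule.mem_iSup_of_mem i.down ⟨x, rfl⟩
      have h := Submodule.inner_right_of_mem_orthogonal hx hz
      rw [hV, lp.inner_single_left] at h
      exact h.trans (inner_zero_right x).symm

theorem theorem2p5 :
    -- existence of an irreducible universal contraction, of the stated form
    (∃ (H : Type u) (_ : NormedAddCommGroup H) (_ : InnerProductSpace ℂ H) (_ : CompleteSpace H)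
      (T : H →L[ℂ] H),
      IsUniversalContraction T ∧ IsIrreducibleOperator T ∧
        ∃ D C : H →L[ℂ] H,
          IsDirectSumOfDenseMatrixContractions D ∧ IsCompactOperator C ∧ T = D + C) ∧
    -- the algebra generated by any universal contraction is primitive, and its faithful irreducible
    -- representations are those that send the generator to an irreducible universal contraction
    (∀ (H : Type u) [NormedAddCommGroup H] [InnerProductSpace ℂ H] [CompleteSpace H]
      (T : H →L[ℂ] H), IsUniversalContraction T →
        IsPrimitiveCStarAlgebra (CStarGen T) ∧
        ∀ (K : Type u) [NormedAddCommGroup K] [InnerProductSpace ℂ K] [CompleteSpace K]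
          (π : CStarGen T →⋆ₐ[ℂ] (K →L[ℂ] K)),
          (Function.Injective π ∧ IsIrreducibleRep π) ↔
            (IsUniversalContraction (π (CStarGen.gen T)) ∧
              IsIrreducibleOperator (π (CStarGen.gen T)))) := by
  refine ⟨exists_irreducible_universal_contraction, fun H _ _ _ T hT => ⟨?_, fun K _ _ _ π =>
    injective_and_isIrreducibleRep_iff hT π⟩⟩
  obtain ⟨K, _, _, _, S, hS, hS', -⟩ := exists_irreducible_universal_contraction.{u}
  exact isPrimitiveCStarAlgebra_of_isUniversalContraction hT hS hS'
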